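/- Let $K$ be a field, let the node set $[n]=\{1,\dots,n\}$ be partitioned into nonempty blocks $B_1,\dots,B_k$, and let $z:[n]\to[k]$ be the block assignment ($u\in B_{z(u)}$). Let $K[x]=K[x_{uv}]$ have one variable $x_{uv}=x_{vu}$ for each edge $\{u,v\}$, $u\ne v$, of the complete graph $K_n$. Let $I\subset K[x]$ be the toric ideal of the $(n,2)$-hypersimplex, i.e. the kernel of the $K$-algebra homomorphism $K[x]\to K[\beta_1,\dots,\beta_n]$, $x_{uv}\mapsto \beta_u\beta_v$, and let $I_{\mathrm{Add}}$ be the toric ideal of the additive stochastic block model, i.e. the kernel of $K[x]\to K[t_1,\dots,t_k]$, $x_{uv}\mapsto t_{z(u)}t_{z(v)}$. Let the sorted basis be $$\mathcal G=\{x_{ab}x_{cd}-x_{ac}x_{bd},\ x_{ad}x_{bc}-x_{ac}x_{bd}\;:\;1\le a<b<c<d\le n\}$$ and let $$\mathcal L=\{x_{uv}-x_{yw}\;:\;u\neq v,\ y\neq w,\ u,y\in B_i,\ v,w\in B_j,\ i,j\in[k]\}.$$ For a monomial order, a Gröbner basis of an ideal is a finite subset whose leading terms generate the initial ideal; it is reduced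 if its elements are monic and no monomial of an element is divisible by the leading monomial of another element. **Theorem.** 1. There is a monomial order for which $\mathcal G$ is the reduced Gröbner basis of $I$. 2. There is a monomial order for which $\mathcal G\cup\mathcal L$ is a Gröbner basis of $I_{\mathrm{Add}}$. If the nodes are labelled so that the blocks are consecutive ($z$ is nondecreasing), then $\mathcal G\cup\mathcal L$ is a Gröbner basis of $I_{\mathrm{Add}}$ for every monomial order for which $\mathcal G$ is the reduced Gröbner basis of $I$. 3. A Markov basis of the additive stochastic block model is given by the exchanges of edges along sorted 4-cycles and the exchanges of an edge for another edge whose endpoints lie in the same respective blocks. Here a sorted 4-cycle is a 4-cycle of $K_n$ on nodes $a<b<c<d$ one of whose two perfect matchings is $\{ac,bd\}$, and the exchange along it replaces one of its perfect matchings by the other. Precisely: for a multigraph $g\in\mathbb N^{\binom n2}$ on $[n]$ without loops, with degrees $\deg_g(v)$, let $T_{\mathrm{Add}}(g)=\bigl(\sum_{v\in B_i}\deg_g(v)\bigr)_{i\in[k]}$. These finitely many moves (integer vectors in $\mathbb Z^{\binom n2}$) preserve $T_{\mathrm{Add}}$, and any two multigraphs $g,h\in\mathbb N^{\binom n2}$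 with $T_{\mathrm{Add}}(g)=T_{\mathrm{Add}}(h)$ are joined by a finite sequence of multigraphs in $\mathbb N^{\binom n2}$ with the same value of $T_{\mathrm{Add}}$, each obtained from the previous one by adding or subtracting one of the moves. -/

import Mathlib

open MvPolynomial

namespace AdditiveSBM

/-! ### Gröbner bases -/

section Groebner

variable {σ K : Type*} [Field K]

/-- A finite set `G` is a Gröbner basis of the ideal `I` with respect to the monomial order `m`:
`G ⊆ I`, and the leading terms of the elements of `G` generate the ideal generated by the leading
terms of all elements of `I`. (The leading term of `0` is `0`, so a zero element is harmless.) -/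
def IsGroebnerBasis (m : MonomialOrder σ) (G : Set (MvPolynomial σ K))
    (I : Ideal (MvPolynomial σ K)) : Prop :=
  G.Finite ∧ (∀ g ∈ G, g ∈ I) ∧
    Ideal.span (m.leadingTerm '' G) = Ideal.span (m.leadingTerm '' (I : Set (MvPolynomial σ K)))

/-- `G` is the reduced Gröbner basis of `I` with respect to `m`: a Gröbner basis whose elements are
monic and in which no monomial of an element is divisible by the leading monomial of a different
element. -/
def IsReducedGroebnerBasis (m : MonomialOrder σ) (G : Set (MvPolynomial σ K))
    (I : Ideal (MvPolynomial σ K)) : Prop :=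
  IsGroebnerBasis m G I ∧ (∀ g ∈ G, m.leadingCoeff g = 1) ∧
    ∀ g ∈ G, ∀ g' ∈ G, g' ≠ g → ∀ c ∈ g.support, ¬ m.degree g' ≤ c

end Groebner

/-! ### Edges of the complete graph and the toric ideals -/

/-- The edges `{u, v}`, `u ≠ v`, of the complete graph on `n` nodes. -/
abbrev Edge (n : ℕ) : Type := {e : Sym2 (Fin n) // ¬ e.IsDiag}

/-- The edge `{u, v}`. -/
def edge {n : ℕ} (u v : Fin n) (h : u ≠ v) : Edge n := ⟨s(u, v), by simpa using h⟩

/-- The homomorphism `ρ` with `x_{uv} ↦ β_u β_v`, the parametrization of the `(n,2)`-hypersimplex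
(of the `β`-model). -/
noncomputable def hypersimplexMap (K : Type*) [Field K] (n : ℕ) :
    MvPolynomial (Edge n) K →ₐ[K] MvPolynomial (Fin n) K :=
  aeval fun e => (e.1.map fun u => (X u : MvPolynomial (Fin n) K)).mul

/-- The toric ideal of the `(n,2)`-hypersimplex. -/
noncomputable def hypersimplexIdeal (K : Type*) [Field K] (n : ℕ) :
    Ideal (MvPolynomial (Edge n) K) :=
  RingHom.ker (hypersimplexMap K n)

/-- The homomorphism `φ` with `x_{uv} ↦ t_{z(u)} t_{z(v)}`, where `z` is the block assignment. -/
noncomputable def addMap (K : Type*) [Field K] {n k : ℕ} (z : Fin n → Fin k) :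
    MvPolynomial (Edge n) K →ₐ[K] MvPolynomial (Fin k) K :=
  aeval fun e => (e.1.map fun u => (X (z u) : MvPolynomial (Fin k) K)).mul

/-- The toric ideal of the additive stochastic block model with block assignment `z`. -/
noncomputable def addIdeal (K : Type*) [Field K] {n k : ℕ} (z : Fin n → Fin k) :
    Ideal (MvPolynomial (Edge n) K) :=
  RingHom.ker (addMap K z)

/-- The variable `x_{uv} = x_{vu}`. -/
noncomputable def x (K : Type*) [Field K] {n : ℕ} (u v : Fin n) (h : u ≠ v) :
    MvPolynomial (Edge n) K :=
  X (edge u v h)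

/-- The sorted basis: for nodes `a < b < c < d`, the pair of edges `{a,c}, {b,d}` is sorted, the
other two pairs `{a,b}, {c,d}` and `{a,d}, {b,c}` are not; each unsorted pair gives the binomial
"unsorted minus sorted". -/
def sortedBasis (K : Type*) [Field K] (n : ℕ) : Set (MvPolynomial (Edge n) K) :=
  {p | ∃ (a b c d : Fin n) (hab : a < b) (hbc : b < c) (hcd : c < d),
    p = x K a b hab.ne * x K c d hcd.ne
        - x K a c (hab.trans hbc).ne * x K b d (hbc.trans hcd).ne ∨
    p = x K a d ((hab.trans hbc).trans hcd).ne * x K b c hbc.ne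
        - x K a c (hab.trans hbc).ne * x K b d (hbc.trans hcd).ne}

/-- The linear binomials `x_{uv} - x_{yw}` with `u, y` in one block and `v, w` in one block. -/
def linearBinomials (K : Type*) [Field K] {n k : ℕ} (z : Fin n → Fin k) :
    Set (MvPolynomial (Edge n) K) :=
  {p | ∃ (u v y w : Fin n) (huv : u ≠ v) (hyw : y ≠ w),
    z u = z y ∧ z v = z w ∧ p = x K u v huv - x K y w hyw}

/-! ### Fibers and Markov bases -/

/-- The degree of the node `v` in the multigraph with edge multiplicities `g`. -/
def deg {n : ℕ} (g : Edge n → ℕ) (v : Fin n) : ℕ :=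
  ∑ e : Edge n with v ∈ e.1, g e

/-- The sufficient statistics of the additive model: the sum of the degrees of the nodes of each
block. -/
def suffStat {n k : ℕ} (z : Fin n → Fin k) (g : Edge n → ℕ) (i : Fin k) : ℕ :=
  ∑ v : Fin n with z v = i, deg g v

/-- One step with a move from `M`: `h = g + m` or `h = g - m` for some `m ∈ M`. -/
def MoveStep {E : Type*} (M : Set (E → ℤ)) (g h : E → ℕ) : Prop :=
  ∃ m ∈ M, (∀ e, (h e : ℤ) = g e + m e) ∨ (∀ e, (h e : ℤ) = g e - m e)

/-- `M` is a Markov basis for the statistic `T` on `E → ℕ`: a finite set of moves that preserve `T`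
such that any two elements of a fiber of `T` are connected by steps with moves from `M`, with only
elements of this fiber (in particular nonnegative ones) along the way. -/
def IsMarkovBasis {E S : Type*} (T : (E → ℕ) → S) (M : Set (E → ℤ)) : Prop :=
  M.Finite ∧
  (∀ m ∈ M, ∀ g h : E → ℕ, (∀ e, (h e : ℤ) = g e + m e) → T h = T g) ∧
  ∀ g h : E → ℕ, T g = T h →
    Relation.ReflTransGen (fun g₁ g₂ => MoveStep M g₁ g₂ ∧ T g₂ = T g₁) g h

/-- The indicator vector of an edge. -/
def ind {n : ℕ} (u v : Fin n) (h : u ≠ v) : Edge n → ℤ := Pi.single (edge u v h) 1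

/-- Exchange of edges along a sorted 4-cycle: a 4-cycle on nodes `a < b < c < d` one of whose two
perfect matchings is the sorted pair `{a,c}, {b,d}`; the move replaces one matching by the other. -/
def sortedCycleMoves (n : ℕ) : Set (Edge n → ℤ) :=
  {m | ∃ (a b c d : Fin n) (hab : a < b) (hbc : b < c) (hcd : c < d),
    m = ind a b hab.ne + ind c d hcd.ne
        - ind a c (hab.trans hbc).ne - ind b d (hbc.trans hcd).ne ∨
    m = ind a d ((hab.trans hbc).trans hcd).ne + ind b c hbc.ne
        - ind a c (hab.trans hbc).ne - ind b d (hbc.trans hcd).ne}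

/-- Exchange of an edge for another edge whose endpoints lie in the same respective blocks. -/
def blockMoves {n k : ℕ} (z : Fin n → Fin k) : Set (Edge n → ℤ) :=
  {m | ∃ (u v y w : Fin n) (huv : u ≠ v) (hyw : y ≠ w),
    z u = z y ∧ z v = z w ∧ m = ind u v huv - ind y w hyw}

end AdditiveSBM

/-! Both toric ideals are kernels of monomial maps, so all claims concern the fibers of an additive
statistic `T` on exponents. Every binomial in question has its two monomials in one fiber. Call an
exponent reducible if it is divisible by the larger monomial of some binomial; replacing that
monomial by the smaller one descends within the fiber and must stop. If each fiber contains at most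
one irreducible exponent (`Separating`), then any two elements of a fiber are joined through their
common normal form, which gives the Markov basis. The leading monomial of a kernel element must
moreover be reducible, since its image could not cancel otherwise, which gives the Gröbner basis.

To prove separation, give the blocks distinct numerical labels, so that each edge becomes an ordered
pair of labels. In an irreducible exponent the linear binomials leave only one edge for each pair of
labels. The quadratic ones should forbid two edges whose label intervals are disjoint or strictly
nested. A multiset of pairs with this property is determined by the multiset of all its entries
(`multiset_eq_of_sorted`), which is what the statistic records.

For consecutive blocks the label is the block index: disjoint or nested label intervals come from
unsorted pairs of edges, so any order in which unsorted monomials lead will do. Reducedness of the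
sorted basis forces this, because each sorted monomial occurs in two of its binomials. For arbitrary
blocks, choose a representative node in each block as its label, and take an order whose weight is
strictly concave in the distance of labels, with ties broken in favour of edges between
representatives (`separating_labelOrder`). Singleton blocks give the hypersimplex. -/

namespace AdditiveSBM

/-! ### Weighted monomial orders -/

section Weighted

variable {σ : Type} (m : MonomialOrder.{0, 0} σ) (w : (σ →₀ ℕ) →+ ℕ)

/-- The exponents, ordered first by the weight `w` and then by the monomial order `m`. -/
def WeightedSyn (_ : MonomialOrder.{0, 0} σ) (_ : (σ →₀ ℕ) →+ ℕ) : Type := σ →₀ ℕ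

noncomputable instance : AddCommMonoid (WeightedSyn m w) :=
  inferInstanceAs (AddCommMonoid (σ →₀ ℕ))

/-- The weight of an exponent followed by its image under `m.toSyn`. -/
noncomputable def weightedKey : WeightedSyn m w → ℕ ×ₗ m.syn :=
  fun c => toLex (w c, m.toSyn c)

theorem weightedKey_injective : Function.Injective (weightedKey m w) := fun _ _ h =>
  m.toSyn.injective (congrArg (fun q => (ofLex q).2) h)

theorem weightedKey_add (a b : WeightedSyn m w) :
    weightedKey m w (a + b) =
      toLex ((ofLex (weightedKey m w a)).1 + (ofLex (weightedKey m w b)).1,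
        (ofLex (weightedKey m w a)).2 + (ofLex (weightedKey m w b)).2) := by
  have h₁ : w (a + b : σ →₀ ℕ) = w a + w b := map_add w _ _
  have h₂ : m.toSyn (a + b : σ →₀ ℕ) = m.toSyn a + m.toSyn b := map_add m.toSyn _ _
  exact congrArg toLex (Prod.ext h₁ h₂)

noncomputable instance : LinearOrder (WeightedSyn m w) :=
  LinearOrder.lift' (weightedKey m w) (weightedKey_injective m w)

theorem weightedSyn_le_iff {a b : WeightedSyn m w} :
    a ≤ b ↔ weightedKey m w a ≤ weightedKey m w b := Iff.rfl

instance : IsOrderedAddMonoid (WeightedSyn m w) where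
  add_le_add_left a b h c := by
    rw [weightedSyn_le_iff] at h ⊢
    rw [weightedKey_add, weightedKey_add]
    rw [Prod.Lex.le_iff] at h ⊢
    simpa using h

instance : WellFoundedLT (WeightedSyn m w) :=
  ⟨InvImage.wf (weightedKey m w) wellFounded_lt⟩

/-- The monomial order that compares weights first and breaks ties by `m`. -/
noncomputable def weightedOrder : MonomialOrder.{0, 0} σ where
  syn := WeightedSyn m w
  toSyn := { Equiv.refl (σ →₀ ℕ) with map_add' := fun _ _ => rfl }
  toSyn_monotone a b h := by
    obtain ⟨d, rfl⟩ := exists_add_of_le h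
    refine Prod.Lex.le_iff.2 ?_
    have h₁ : w (a + d) = w a + w d := map_add w _ _
    have h₂ : m.toSyn a ≤ m.toSyn (a + d) := m.toSyn_monotone h
    change w a < w (a + d) ∨ w a = w (a + d) ∧ m.toSyn a ≤ m.toSyn (a + d)
    rcases Nat.eq_zero_or_pos (w d) with h | h
    · exact Or.inr ⟨by omega, h₂⟩
    · exact Or.inl (by omega)

theorem weightedOrder_lt_iff {a b : σ →₀ ℕ} :
    (weightedOrder m w).toSyn a < (weightedOrder m w).toSyn b ↔
      w a < w b ∨ w a = w b ∧ m.toSyn a < m.toSyn b :=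
  Prod.Lex.lt_iff (x := weightedKey m w a) (y := weightedKey m w b)

end Weighted

/-! ### Binomials -/

section Binomials

variable {σ τ : Type*} (m : MonomialOrder σ) (S : Set ((σ →₀ ℕ) × (σ →₀ ℕ)))

/-- `c` is divisible by the larger of the two monomials of a pair of `S`. -/
def Reducible (c : σ →₀ ℕ) : Prop :=
  ∃ P Q, ((P, Q) ∈ S ∨ (Q, P) ∈ S) ∧ m.toSyn Q < m.toSyn P ∧ P ≤ c

/-- Every fiber of `T` has at most one element that is not reducible by `S`. -/
def Separating (T : (σ →₀ ℕ) →+ (τ →₀ ℕ)) : Prop :=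
  ∀ c c', T c = T c' → ¬ Reducible m S c → ¬ Reducible m S c' → c = c'

/-- One step from `c` to `c'` with a pair of `S`. -/
def BinomialStep (c c' : σ →₀ ℕ) : Prop :=
  ∃ P Q, ((P, Q) ∈ S ∨ (Q, P) ∈ S) ∧ c + Q = c' + P

/-- The binomial with exponents `P` and `Q`. -/
noncomputable def binomial (K : Type*) [Field K] (p : (σ →₀ ℕ) × (σ →₀ ℕ)) : MvPolynomial σ K :=
  monomial p.1 1 - monomial p.2 1

variable {m S}

theorem Reducible.exists_step {c : σ →₀ ℕ} (h : Reducible m S c) :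
    ∃ c', BinomialStep S c c' ∧ m.toSyn c' < m.toSyn c := by
  obtain ⟨P, Q, hS, hlt, hle⟩ := h
  obtain ⟨d, rfl⟩ := exists_add_of_le hle
  refine ⟨d + Q, ⟨P, Q, hS, by abel⟩, ?_⟩
  rw [map_add, map_add, add_comm]
  exact add_lt_add_left hlt _

theorem BinomialStep.symm {c c' : σ →₀ ℕ} (h : BinomialStep S c c') : BinomialStep S c' c := by
  obtain ⟨P, Q, hS, h⟩ := h
  exact ⟨Q, P, hS.symm, h.symm⟩

theorem BinomialStep.map_eq {T : (σ →₀ ℕ) →+ (τ →₀ ℕ)} (hT : ∀ p ∈ S, T p.1 = T p.2)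
    {c c' : σ →₀ ℕ} (h : BinomialStep S c c') : T c' = T c := by
  obtain ⟨P, Q, hS, h⟩ := h
  have hPQ : T P = T Q := hS.elim (fun h => hT _ h) (fun h => (hT _ h).symm)
  have := congrArg T h
  rw [map_add, map_add, hPQ] at this
  exact (add_right_cancel this).symm

-- Each reduction strictly lowers the exponent in a well-order while staying in the fiber, so
-- reduction terminates.
variable (m) in
theorem exists_irreducible {T : (σ →₀ ℕ) →+ (τ →₀ ℕ)} (hT : ∀ p ∈ S, T p.1 = T p.2)
    (c : σ →₀ ℕ) : ∃ c', ¬ Reducible m S c' ∧ m.toSyn c' ≤ m.toSyn c ∧ T c' = T c ∧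
      Relation.ReflTransGen (fun a b => BinomialStep S a b ∧ T b = T a) c c' := by
  induction h : m.toSyn c using WellFoundedLT.induction generalizing c with
  | ind s ih =>
    subst h
    by_cases hc : Reducible m S c
    · obtain ⟨d, hstep, hlt⟩ := hc.exists_step
      obtain ⟨c', h₁, h₂, h₃, h₄⟩ := ih _ hlt d rfl
      have hd := hstep.map_eq hT
      exact ⟨c', h₁, h₂.trans hlt.le, h₃.trans hd, .head ⟨hstep, hd⟩ h₄⟩
    · exact ⟨c, hc, le_rfl, rfl, .refl⟩

/-- Both exponents reduce to the same normal form; follow one reduction and then the other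
backwards. -/
theorem Separating.reflTransGen {T : (σ →₀ ℕ) →+ (τ →₀ ℕ)} (hS : Separating m S T)
    (hT : ∀ p ∈ S, T p.1 = T p.2) {c d : σ →₀ ℕ} (h : T c = T d) :
    Relation.ReflTransGen (fun a b => BinomialStep S a b ∧ T b = T a) c d := by
  obtain ⟨c', hc₁, -, hc₃, hc₄⟩ := exists_irreducible m hT c
  obtain ⟨d', hd₁, -, hd₃, hd₄⟩ := exists_irreducible m hT d
  obtain rfl := hS c' d' (by rw [hc₃, hd₃, h]) hc₁ hd₁
  have : Std.Symm fun a b => BinomialStep S a b ∧ T b = T a :=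
    ⟨fun _ _ hab => ⟨hab.1.symm, hab.2.symm⟩⟩
  exact hc₄.trans (symm hd₄)

/-- An irreducible `b` would be the normal form of `a`, but normal forms are never larger than what
they come from. -/
theorem Separating.reducible_of_lt {T : (σ →₀ ℕ) →+ (τ →₀ ℕ)} (hS : Separating m S T)
    (hT : ∀ p ∈ S, T p.1 = T p.2) {a b : σ →₀ ℕ} (h : T a = T b) (hlt : m.toSyn a < m.toSyn b) :
    Reducible m S b := by
  by_contra hb
  obtain ⟨a', h₁, h₂, h₃, -⟩ := exists_irreducible m hT a
  obtain rfl := hS a' b (h₃.trans h) h₁ hb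
  exact absurd hlt h₂.not_gt

variable {K : Type*} [Field K]

theorem degree_binomial {P Q : σ →₀ ℕ} (h : m.toSyn Q < m.toSyn P) :
    m.degree (binomial K (P, Q)) = P ∧ m.leadingCoeff (binomial K (P, Q)) = 1 := by
  classical
  have h' : m.toSyn (m.degree (monomial Q (1 : K))) < m.toSyn (m.degree (monomial P (1 : K))) := by
    simpa [m.degree_monomial] using h
  constructor
  · rw [binomial, m.degree_sub_of_lt h']
    simp [m.degree_monomial]
  · rw [binomial, m.leadingCoeff_sub_of_lt h']
    simp

theorem binomial_swap (P Q : σ →₀ ℕ) : binomial K (P, Q) = -binomial K (Q, P) := by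
  simp [binomial]

theorem monomial_mem_span_leadingTerm {P Q : σ →₀ ℕ} (hS : (P, Q) ∈ S ∨ (Q, P) ∈ S)
    (h : m.toSyn Q < m.toSyn P) :
    monomial P (1 : K) ∈ Ideal.span (m.leadingTerm '' (binomial K '' S)) := by
  obtain ⟨h₁, h₂⟩ := degree_binomial (K := K) h
  have hlt : m.leadingTerm (binomial K (P, Q)) = monomial P 1 := by
    rw [MonomialOrder.leadingTerm, h₁, h₂]
  rcases hS with hS | hS
  · rw [← hlt]
    exact Ideal.subset_span ⟨_, ⟨_, hS, rfl⟩, rfl⟩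
  -- With the pair stored the other way round the leading coefficient is `-1`, which does not affect
  -- the ideal.
  · have : m.leadingTerm (binomial K (Q, P)) = -monomial P 1 := by
      rw [binomial_swap, ← hlt]
      simp [MonomialOrder.leadingTerm]
    rw [← neg_mem_iff, ← this]
    exact Ideal.subset_span ⟨_, ⟨_, hS, rfl⟩, rfl⟩

/-- Binomials that separate the fibers of `T` form a Gröbner basis of the kernel of the monomial
map with exponents given by `T`. -/
theorem Separating.isGroebnerBasis {T : (σ →₀ ℕ) →+ (τ →₀ ℕ)} (hS : Separating m S T)
    (hT : ∀ p ∈ S, T p.1 = T p.2) (hfin : S.Finite)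
    (φ : MvPolynomial σ K →ₐ[K] MvPolynomial τ K)
    (hφ : ∀ c, φ (monomial c 1) = monomial (T c) 1) :
    IsGroebnerBasis m (binomial K '' S) (RingHom.ker φ) := by
  classical
  have hG : ∀ g ∈ binomial K '' S, g ∈ RingHom.ker φ := by
    rintro _ ⟨p, hp, rfl⟩
    rw [RingHom.mem_ker, binomial, map_sub, hφ, hφ, hT p hp, sub_self]
  refine ⟨hfin.image _, hG, le_antisymm (Ideal.span_mono (Set.image_mono hG)) ?_⟩
  rw [Ideal.span_le]
  rintro _ ⟨f, hf, rfl⟩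
  by_cases hf0 : f = 0
  · simp [hf0]
  -- If the leading monomial were irreducible, no smaller monomial would lie in its fiber. Its
  -- coefficient would then survive under `φ`, contradicting `φ f = 0`.
  have hred : Reducible m S (m.degree f) := by
    by_contra hirr
    have hcoeff : (φ f).coeff (T (m.degree f)) = m.leadingCoeff f := by
      have hsum : φ f = ∑ c ∈ f.support, φ (monomial c (coeff c f)) := by
        conv_lhs => rw [f.as_sum, map_sum]
      rw [hsum, coeff_sum, Finset.sum_eq_single (m.degree f)]
      · rw [← mul_one (coeff _ f), ← smul_eq_mul, ← smul_monomial, map_smul, hφ]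
        simp [MonomialOrder.leadingCoeff]
      · intro c hc hne
        rw [← mul_one (coeff _ f), ← smul_eq_mul, ← smul_monomial, map_smul, hφ, coeff_smul,
          coeff_monomial, if_neg, smul_zero]
        intro hTc
        exact hirr (hS.reducible_of_lt hT hTc
          (lt_of_le_of_ne (m.le_degree hc) fun h => hne (m.toSyn.injective h)))
      · exact fun h => absurd (m.degree_mem_support hf0) h
    have hf' : φ f = 0 := hf
    rw [hf', coeff_zero] at hcoeff
    exact hf0 (m.leadingCoeff_eq_zero_iff.1 hcoeff.symm)
  obtain ⟨P, Q, hPQ, hlt, hle⟩ := hred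
  obtain ⟨d, hd⟩ := exists_add_of_le hle
  have : m.leadingTerm f = monomial d (m.leadingCoeff f) * monomial P 1 := by
    rw [MonomialOrder.leadingTerm, monomial_mul, mul_one, hd, add_comm]
  rw [this]
  exact Ideal.mul_mem_left _ _ (monomial_mem_span_leadingTerm hPQ hlt)

end Binomials

/-! ### Sorted multisets of pairs -/

/-- Sort the pairs lexicographically. The hypotheses say that the list of first entries followed by
the list of second entries is weakly increasing, so it is determined by the multiset of all entries;
cutting it in half recovers the pairs. -/
theorem multiset_eq_of_sorted {s t : Multiset (ℕ × ℕ)}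
    (hs : ∀ p ∈ s, ∀ q ∈ s, p.1 ≤ q.2 ∧ (p.1 < q.1 → p.2 ≤ q.2))
    (ht : ∀ p ∈ t, ∀ q ∈ t, p.1 ≤ q.2 ∧ (p.1 < q.1 → p.2 ≤ q.2))
    (h : s.map Prod.fst + s.map Prod.snd = t.map Prod.fst + t.map Prod.snd) : s = t := by
  have key : ∀ s : Multiset (ℕ × ℕ),
      (∀ p ∈ s, ∀ q ∈ s, p.1 ≤ q.2 ∧ (p.1 < q.1 → p.2 ≤ q.2)) →
      ∃ l : List (ℕ × ℕ), (l : Multiset (ℕ × ℕ)) = s ∧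
        (l.map Prod.fst ++ l.map Prod.snd).Pairwise (· ≤ ·) := by
    intro s hs
    let l := (s.map toLex).sort (· ≤ ·)
    have hl : (l : Multiset (ℕ ×ₗ ℕ)) = s.map toLex := Multiset.sort_eq _ _
    have hl' : l.Pairwise (· ≤ ·) := Multiset.pairwise_sort _ _
    have hmem : ∀ p ∈ l, ofLex p ∈ s := by
      intro p hp
      have : p ∈ s.map toLex := by rw [← hl]; exact hp
      obtain ⟨q, hq, rfl⟩ := Multiset.mem_map.1 this
      exact hq
    refine ⟨l.map ofLex, ?_, ?_⟩
    · rw [← Multiset.map_coe, hl, Multiset.map_map]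
      exact Multiset.map_id s
    · rw [List.pairwise_append]
      refine ⟨?_, ?_, ?_⟩
      · rw [List.map_map, List.pairwise_map]
        refine hl'.imp fun {p q} hpq => ?_
        rcases Prod.Lex.le_iff.1 hpq with h | h
        · exact h.le
        · exact h.1.le
      · rw [List.map_map, List.pairwise_map]
        refine hl'.imp_of_mem fun {p q} hp hq hpq => ?_
        rcases Prod.Lex.le_iff.1 hpq with h | h
        · exact (hs _ (hmem _ hp) _ (hmem _ hq)).2 h
        · exact h.2
      · intro a ha b hb
        simp only [List.mem_map] at ha hb
        obtain ⟨_, ⟨p, hp, rfl⟩, rfl⟩ := ha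
        obtain ⟨_, ⟨q, hq, rfl⟩, rfl⟩ := hb
        exact (hs _ (hmem _ hp) _ (hmem _ hq)).1
  obtain ⟨l, rfl, hl⟩ := key s hs
  obtain ⟨r, rfl, hr⟩ := key t ht
  simp only [Multiset.map_coe, Multiset.coe_add, Multiset.coe_eq_coe] at h
  have heq := h.eq_of_pairwise (le := (· ≤ ·)) (fun _ _ _ _ => le_antisymm) hl hr
  have hlen : l.length = r.length := by
    have := congrArg List.length heq
    simp at this
    omega
  obtain ⟨h₁, h₂⟩ := List.append_inj heq (by simpa using hlen)
  have : l = r := by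
    rw [← List.zip_unzip l, ← List.zip_unzip r, List.unzip_eq_map, List.unzip_eq_map, h₁, h₂]
  rw [this]

/-! ### Edges and pairs of edges -/

section Edges

variable {n k : ℕ}

theorem edge_comm {u v : Fin n} (h : u ≠ v) : edge u v h = edge v u h.symm :=
  Subtype.ext Sym2.eq_swap

theorem edge_eq_iff {u v y w : Fin n} (h : u ≠ v) (h' : y ≠ w) :
    edge u v h = edge y w h' ↔ u = y ∧ v = w ∨ u = w ∧ v = y := by
  rw [edge, edge, Subtype.mk.injEq, Sym2.eq_iff]

theorem exists_edge_le (l : Fin n → ℕ) (e : Edge n) :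
    ∃ (u v : Fin n) (h : u ≠ v), e = edge u v h ∧ l u ≤ l v := by
  obtain ⟨e, he⟩ := e
  induction e using Sym2.inductionOn with
  | hf u v =>
    have huv : u ≠ v := by simpa using he
    rcases le_total (l u) (l v) with h | h
    · exact ⟨u, v, huv, rfl, h⟩
    · exact ⟨v, u, huv.symm, edge_comm huv, h⟩

/-- The exponent of the product of the variables of two edges. -/
noncomputable def pairExp (e f : Edge n) : Edge n →₀ ℕ := Finsupp.single e 1 + Finsupp.single f 1

theorem pairExp_comm (e f : Edge n) : pairExp e f = pairExp f e := add_comm _ _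

theorem pairExp_eq_iff {e f e' f' : Edge n} :
    pairExp e f = pairExp e' f' ↔ e = e' ∧ f = f' ∨ e = f' ∧ f = e' := by
  rw [pairExp, pairExp, Finsupp.single_add_single_eq_single_add_single one_ne_zero one_ne_zero]
  simp

/-- Distinctness matters: for `e = f` the multiplicity would have to be at least two. -/
theorem pairExp_le {c : Edge n →₀ ℕ} {e f : Edge n} (hef : e ≠ f) (he : e ∈ c.support)
    (hf : f ∈ c.support) : pairExp e f ≤ c := by
  classical
  intro g
  rw [Finsupp.mem_support_iff] at he hf
  rw [pairExp, Finsupp.add_apply, Finsupp.single_apply, Finsupp.single_apply]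
  split_ifs with h₁ h₂ h₂
  · exact absurd (h₁.trans h₂.symm) hef
  · subst h₁; omega
  · subst h₂; omega
  · omega

/-- Both exponents have degree two, so divisibility leaves no room for a cofactor. -/
theorem pairExp_eq_of_le {e f e' f' : Edge n} (h : pairExp e f ≤ pairExp e' f') :
    pairExp e f = pairExp e' f' := by
  obtain ⟨d, hd⟩ := exists_add_of_le h
  have := congrArg Finsupp.degree hd
  simp only [pairExp, map_add, Finsupp.degree_single] at this
  have hd0 : d = 0 := (Finsupp.degree_eq_zero_iff d).1 (by omega)
  rw [hd, hd0, add_zero]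

/-- The exponents of the binomials of the sorted basis. -/
def sortedPairs (n : ℕ) : Set ((Edge n →₀ ℕ) × (Edge n →₀ ℕ)) :=
  {p | ∃ (a b c d : Fin n) (hab : a < b) (hbc : b < c) (hcd : c < d),
    p = (pairExp (edge a b hab.ne) (edge c d hcd.ne),
      pairExp (edge a c (hab.trans hbc).ne) (edge b d (hbc.trans hcd).ne)) ∨
    p = (pairExp (edge a d ((hab.trans hbc).trans hcd).ne) (edge b c hbc.ne),
      pairExp (edge a c (hab.trans hbc).ne) (edge b d (hbc.trans hcd).ne))}

/-- The exponents of the linear binomials. -/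
def blockPairs (z : Fin n → Fin k) : Set ((Edge n →₀ ℕ) × (Edge n →₀ ℕ)) :=
  {p | ∃ (u v y w : Fin n) (huv : u ≠ v) (hyw : y ≠ w),
    z u = z y ∧ z v = z w ∧
      p = (Finsupp.single (edge u v huv) 1, Finsupp.single (edge y w hyw) 1)}

theorem finite_sortedPairs (n : ℕ) : (sortedPairs n).Finite := by
  refine (Set.finite_range fun q : (Edge n × Edge n) × (Edge n × Edge n) =>
    (pairExp q.1.1 q.1.2, pairExp q.2.1 q.2.2)).subset ?_
  rintro p ⟨a, b, c, d, hab, hbc, hcd, rfl | rfl⟩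
  · exact ⟨((_, _), (_, _)), rfl⟩
  · exact ⟨((_, _), (_, _)), rfl⟩

theorem finite_blockPairs (z : Fin n → Fin k) : (blockPairs z).Finite := by
  refine (Set.finite_range fun q : Edge n × Edge n =>
    (Finsupp.single q.1 1, Finsupp.single q.2 1)).subset ?_
  rintro p ⟨u, v, y, w, huv, hyw, -, -, rfl⟩
  exact ⟨(_, _), rfl⟩

theorem sortedPairs_snd_eq {p q : (Edge n →₀ ℕ) × (Edge n →₀ ℕ)} (hp : p ∈ sortedPairs n)
    (hq : q ∈ sortedPairs n) (h : p.1 = q.1) : p.2 = q.2 := by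
  obtain ⟨a, b, c, d, hab, hbc, hcd, rfl | rfl⟩ := hp <;>
  obtain ⟨a', b', c', d', hab', hbc', hcd', rfl | rfl⟩ := hq <;>
  simp only [pairExp_eq_iff, edge_eq_iff] at h ⊢ <;> omega

theorem sortedPairs_fst_ne_snd {p q : (Edge n →₀ ℕ) × (Edge n →₀ ℕ)} (hp : p ∈ sortedPairs n)
    (hq : q ∈ sortedPairs n) : p.1 ≠ q.2 := by
  intro h
  obtain ⟨a, b, c, d, hab, hbc, hcd, rfl | rfl⟩ := hp <;>
  obtain ⟨a', b', c', d', hab', hbc', hcd', rfl | rfl⟩ := hq <;>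
  simp only [pairExp_eq_iff, edge_eq_iff] at h <;> omega

theorem sortedPairs_fst_eq_of_le {p q : (Edge n →₀ ℕ) × (Edge n →₀ ℕ)} (hp : p ∈ sortedPairs n)
    (hq : q ∈ sortedPairs n) (h : p.1 ≤ q.1) : p.1 = q.1 := by
  obtain ⟨a, b, c, d, hab, hbc, hcd, rfl | rfl⟩ := hp <;>
  obtain ⟨a', b', c', d', hab', hbc', hcd', rfl | rfl⟩ := hq <;>
  exact pairExp_eq_of_le h

theorem sortedPairs_not_fst_le_snd {p q : (Edge n →₀ ℕ) × (Edge n →₀ ℕ)} (hp : p ∈ sortedPairs n)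
    (hq : q ∈ sortedPairs n) : ¬ p.1 ≤ q.2 := by
  intro h
  refine sortedPairs_fst_ne_snd hp hq ?_
  obtain ⟨a, b, c, d, hab, hbc, hcd, rfl | rfl⟩ := hp <;>
  obtain ⟨a', b', c', d', hab', hbc', hcd', rfl | rfl⟩ := hq <;>
  exact pairExp_eq_of_le h

/-- A sorted matching is shared by the binomials of the two unsorted matchings on the same four
nodes. This prevents it from leading in a reduced basis. -/
theorem exists_sortedPairs_ne {p : (Edge n →₀ ℕ) × (Edge n →₀ ℕ)} (hp : p ∈ sortedPairs n) :
    ∃ q ∈ sortedPairs n, q.2 = p.2 ∧ q.1 ≠ p.1 := by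
  obtain ⟨a, b, c, d, hab, hbc, hcd, rfl | rfl⟩ := hp
  · refine ⟨_, ⟨a, b, c, d, hab, hbc, hcd, Or.inr rfl⟩, rfl, fun h => ?_⟩
    simp only [pairExp_eq_iff, edge_eq_iff] at h
    omega
  · refine ⟨_, ⟨a, b, c, d, hab, hbc, hcd, Or.inl rfl⟩, rfl, fun h => ?_⟩
    simp only [pairExp_eq_iff, edge_eq_iff] at h
    omega

/-- Two disjoint edges form a pair of `sortedPairs` with one of the two other perfect matchings of
their end nodes. -/
theorem exists_sortedPairs_of_disjoint {u v y w : Fin n} (huv : u ≠ v) (hyw : y ≠ w)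
    (huy : u ≠ y) (huw : u ≠ w) (hvy : v ≠ y) (hvw : v ≠ w) :
    ∃ Q, ((pairExp (edge u v huv) (edge y w hyw), Q) ∈ sortedPairs n ∨
        (Q, pairExp (edge u v huv) (edge y w hyw)) ∈ sortedPairs n) ∧
      (Q = pairExp (edge u y huy) (edge v w hvw) ∨ Q = pairExp (edge u w huw) (edge v y hvy)) := by
  wlog h₁ : u < v generalizing u v
  · obtain ⟨Q, hQ, h⟩ := this huv.symm hvy hvw huy huw (by omega)
    rw [edge_comm huv.symm] at hQ
    refine ⟨Q, hQ, h.symm.imp ?_ ?_⟩ <;> rintro rfl <;> rw [pairExp_comm]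
  wlog h₂ : y < w generalizing y w
  · obtain ⟨Q, hQ, h⟩ := this hyw.symm huw huy hvw hvy (by omega)
    rw [edge_comm hyw.symm] at hQ
    exact ⟨Q, hQ, h.symm⟩
  wlog h₃ : u < y generalizing u v y w
  · obtain ⟨Q, hQ, h⟩ := this hyw h₂ huv huy.symm hvy.symm huw.symm hvw.symm h₁ (by omega)
    rw [pairExp_comm] at hQ
    refine ⟨Q, hQ, h.imp ?_ ?_⟩
    · rintro rfl
      rw [edge_comm huy, edge_comm hvw]
    · rintro rfl
      rw [edge_comm huw, edge_comm hvy, pairExp_comm]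
  -- With `u` the smallest node, the position of `v` relative to `y < w` decides whether the given
  -- edges are disjoint, crossing (the sorted matching) or nested intervals.
  rcases lt_or_gt_of_ne hvy with h | h
  · exact ⟨_, Or.inl ⟨u, v, y, w, h₁, h, h₂, Or.inl rfl⟩, Or.inl rfl⟩
  rcases lt_or_gt_of_ne hvw with h' | h'
  · exact ⟨_, Or.inr ⟨u, y, v, w, h₃, h, h', Or.inl rfl⟩, Or.inl rfl⟩
  · refine ⟨_, Or.inl ⟨u, y, w, v, h₃, h₂, h', Or.inr rfl⟩, Or.inr ?_⟩
    rw [edge_comm hvy]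

end Edges

/-! ### The sufficient statistic on exponents -/

section Stat

variable {n k : ℕ} (z : Fin n → Fin k)

/-- The exponent of `t_{z(u)} t_{z(v)}`. -/
noncomputable def edgeStat (e : Edge n) : Fin k →₀ ℕ :=
  Sym2.lift ⟨fun u v => Finsupp.single (z u) 1 + Finsupp.single (z v) 1, fun _ _ => add_comm _ _⟩
    e.1

theorem edgeStat_edge {u v : Fin n} (h : u ≠ v) :
    edgeStat z (edge u v h) = Finsupp.single (z u) 1 + Finsupp.single (z v) 1 := rfl

/-- The exponent of the image of a monomial under `addMap`. -/
noncomputable def stat : (Edge n →₀ ℕ) →+ (Fin k →₀ ℕ) := Finsupp.weight (edgeStat z)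

theorem stat_single (e : Edge n) (r : ℕ) : stat z (Finsupp.single e r) = r • edgeStat z e :=
  Finsupp.weight_single _ _ _

theorem addMap_monomial (K : Type*) [Field K] (c : Edge n →₀ ℕ) :
    addMap K z (monomial c 1) = monomial (stat z c) 1 := by
  induction c using Finsupp.induction_linear with
  | zero => simp
  | add c d hc hd =>
    rw [map_add, ← one_mul (1 : K), ← monomial_mul, ← monomial_mul, map_mul, hc, hd]
  | single e r =>
    obtain ⟨u, v, h, rfl, -⟩ := exists_edge_le (fun _ => 0) e
    rw [← one_pow r, ← Finsupp.smul_single_one, ← monomial_pow, map_pow, map_nsmul, ← monomial_pow]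
    congr 1
    rw [stat_single, one_smul, edgeStat_edge, ← one_mul (1 : K), ← monomial_mul, one_mul]
    change addMap K z (X (edge u v h)) = X (z u) * X (z v)
    rw [addMap, aeval_X]
    rfl

theorem stat_eq_of_mem_sortedPairs : ∀ p ∈ sortedPairs n, stat z p.1 = stat z p.2 := by
  rintro p ⟨a, b, c, d, hab, hbc, hcd, rfl | rfl⟩ <;>
  · simp only [pairExp, map_add, stat_single, edgeStat_edge, one_smul]
    abel

theorem stat_eq_of_mem_blockPairs : ∀ p ∈ blockPairs z, stat z p.1 = stat z p.2 := by
  rintro p ⟨u, v, y, w, huv, hyw, h₁, h₂, rfl⟩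
  simp only [stat_single, edgeStat_edge, h₁, h₂]

theorem stat_eq_of_mem : ∀ p ∈ sortedPairs n ∪ blockPairs z, stat z p.1 = stat z p.2 := by
  rintro p (h | h)
  · exact stat_eq_of_mem_sortedPairs z p h
  · exact stat_eq_of_mem_blockPairs z p h

theorem binomial_image_sortedPairs (K : Type*) [Field K] (n : ℕ) :
    binomial K '' sortedPairs n = sortedBasis K n := by
  have h : ∀ e f e' f' : Edge n, binomial K (pairExp e f, pairExp e' f') =
      X e * X f - X e' * X f' := by
    intro e f e' f'
    simp [binomial, pairExp, X, monomial_mul]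
  ext q
  constructor
  · rintro ⟨p, ⟨a, b, c, d, hab, hbc, hcd, rfl | rfl⟩, rfl⟩
    · exact ⟨a, b, c, d, hab, hbc, hcd, Or.inl (h _ _ _ _)⟩
    · exact ⟨a, b, c, d, hab, hbc, hcd, Or.inr (h _ _ _ _)⟩
  · rintro ⟨a, b, c, d, hab, hbc, hcd, rfl | rfl⟩
    · exact ⟨_, ⟨a, b, c, d, hab, hbc, hcd, Or.inl rfl⟩, h _ _ _ _⟩
    · exact ⟨_, ⟨a, b, c, d, hab, hbc, hcd, Or.inr rfl⟩, h _ _ _ _⟩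

theorem binomial_image_blockPairs (K : Type*) [Field K] :
    binomial K '' blockPairs z = linearBinomials K z := by
  ext q
  constructor
  · rintro ⟨p, ⟨u, v, y, w, huv, hyw, h₁, h₂, rfl⟩, rfl⟩
    exact ⟨u, v, y, w, huv, hyw, h₁, h₂, rfl⟩
  · rintro ⟨u, v, y, w, huv, hyw, h₁, h₂, rfl⟩
    exact ⟨_, ⟨u, v, y, w, huv, hyw, h₁, h₂, rfl⟩, rfl⟩

/-- The labels of the end nodes of an edge, in increasing order. -/
def labelPair (l : Fin n → ℕ) (e : Edge n) : ℕ × ℕ := ((e.1.map l).inf, (e.1.map l).sup)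

theorem labelPair_edge {l : Fin n → ℕ} {u v : Fin n} (h : u ≠ v) (hl : l u ≤ l v) :
    labelPair l (edge u v h) = (l u, l v) := by
  simp [labelPair, edge, hl]

/-- The lower and upper labels together list the labels of all edge ends with multiplicity, and this
is the image of the statistic under `lam`. -/
theorem map_labelPair_eq {lam : Fin k → ℕ} {c d : Edge n →₀ ℕ} (h : stat z c = stat z d) :
    (c.toMultiset.map (labelPair fun u => lam (z u))).map Prod.fst +
        (c.toMultiset.map (labelPair fun u => lam (z u))).map Prod.snd =
      (d.toMultiset.map (labelPair fun u => lam (z u))).map Prod.fst +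
        (d.toMultiset.map (labelPair fun u => lam (z u))).map Prod.snd := by
  have key : ∀ c : Edge n →₀ ℕ, (c.toMultiset.map (labelPair fun u => lam (z u))).map Prod.fst +
      (c.toMultiset.map (labelPair fun u => lam (z u))).map Prod.snd =
      (stat z c).toMultiset.map lam := by
    intro c
    induction c using Finsupp.induction_linear with
    | zero => simp
    | add c d hc hd =>
      simp only [map_add, Multiset.map_add, ← hc, ← hd]
      abel
    | single e r =>
      obtain ⟨u, v, huv, rfl, hl⟩ := exists_edge_le (fun u => lam (z u)) e
      rw [stat_single, edgeStat_edge, map_nsmul, map_add, Finsupp.toMultiset_single,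
        Finsupp.toMultiset_single, Finsupp.toMultiset_single]
      simp [Multiset.map_nsmul, labelPair_edge (l := fun u => lam (z u)) huv hl, ← nsmul_add]
  rw [key, key, h]

variable {z} {m : MonomialOrder.{0, 0} (Edge n)}

/-- In an irreducible exponent every edge is the smallest one with its pair of blocks. -/
theorem single_le_of_irreducible {lam : Fin k → ℕ} (hlam : Function.Injective lam)
    {c : Edge n →₀ ℕ} (hc : ¬ Reducible m (sortedPairs n ∪ blockPairs z) c) {e f : Edge n}
    (he : e ∈ c.support)
    (h : labelPair (fun u => lam (z u)) e = labelPair (fun u => lam (z u)) f) :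
    m.toSyn (Finsupp.single e 1) ≤ m.toSyn (Finsupp.single f 1) := by
  by_contra hlt
  refine hc ⟨Finsupp.single e 1, Finsupp.single f 1, Or.inl (Or.inr ?_), not_le.1 hlt, ?_⟩
  · obtain ⟨u, v, huv, rfl, hl⟩ := exists_edge_le (fun u => lam (z u)) e
    obtain ⟨y, w, hyw, rfl, hl'⟩ := exists_edge_le (fun u => lam (z u)) f
    rw [labelPair_edge huv hl, labelPair_edge hyw hl', Prod.mk.injEq] at h
    exact ⟨u, v, y, w, huv, hyw, hlam h.1, hlam h.2, rfl⟩
  · rw [Finsupp.single_le_iff]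
    exact Nat.one_le_iff_ne_zero.2 (Finsupp.mem_support_iff.1 he)

/-- If the edges of an irreducible exponent are pairwise sorted with respect to an ordering of the
blocks, then the fibers are separated. -/
theorem separating_of_sorted {lam : Fin k → ℕ} (hlam : Function.Injective lam)
    (h : ∀ c : Edge n →₀ ℕ, ¬ Reducible m (sortedPairs n ∪ blockPairs z) c →
      ∀ (u v y w : Fin n) (huv : u ≠ v) (hyw : y ≠ w), edge u v huv ∈ c.support →
        edge y w hyw ∈ c.support → lam (z u) ≤ lam (z v) → lam (z y) ≤ lam (z w) →
        ¬ lam (z v) < lam (z y) ∧ ¬ (lam (z u) < lam (z y) ∧ lam (z w) < lam (z v))) :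
    Separating m (sortedPairs n ∪ blockPairs z) (stat z) := by
  classical
  intro c d hcd hc hd
  set F := labelPair fun u => lam (z u) with hF
  have hsorted : ∀ c : Edge n →₀ ℕ, ¬ Reducible m (sortedPairs n ∪ blockPairs z) c →
      ∀ p ∈ c.toMultiset.map F, ∀ q ∈ c.toMultiset.map F,
        p.1 ≤ q.2 ∧ (p.1 < q.1 → p.2 ≤ q.2) := by
    intro c hc p hp q hq
    obtain ⟨e, he, rfl⟩ := Multiset.mem_map.1 hp
    obtain ⟨f, hf, rfl⟩ := Multiset.mem_map.1 hq
    rw [Finsupp.mem_toMultiset] at he hf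
    obtain ⟨u, v, huv, rfl, hl⟩ := exists_edge_le (fun u => lam (z u)) e
    obtain ⟨y, w, hyw, rfl, hl'⟩ := exists_edge_le (fun u => lam (z u)) f
    rw [hF, labelPair_edge huv hl, labelPair_edge hyw hl']
    have h₁ := h c hc u v y w huv hyw he hf hl hl'
    have h₂ := h c hc y w u v hyw huv hf he hl' hl
    exact ⟨not_lt.1 h₂.1, fun hlt => not_lt.1 fun h' => h₁.2 ⟨hlt, h'⟩⟩
  -- The statistic determines the multiset of label pairs. It remains to recover the edges: each
  -- label pair is realized only by its `m`-smallest edge, so `F` is injective on the edges that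
  -- occur.
  have heq := multiset_eq_of_sorted (hsorted c hc) (hsorted d hd) (map_labelPair_eq z hcd)
  have hinj : ∀ c d : Edge n →₀ ℕ, ¬ Reducible m (sortedPairs n ∪ blockPairs z) c →
      ¬ Reducible m (sortedPairs n ∪ blockPairs z) d → ∀ e ∈ c.toMultiset, ∀ f ∈ d.toMultiset,
        F e = F f → e = f := by
    intro c d hc hd e he f hf hef
    rw [Finsupp.mem_toMultiset] at he hf
    have := m.toSyn.injective (le_antisymm (single_le_of_irreducible hlam hc he hef)
      (single_le_of_irreducible hlam hd hf hef.symm))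
    exact Finsupp.single_left_injective one_ne_zero this
  have hmem : ∀ c d : Edge n →₀ ℕ, ¬ Reducible m (sortedPairs n ∪ blockPairs z) c →
      ¬ Reducible m (sortedPairs n ∪ blockPairs z) d → c.toMultiset.map F = d.toMultiset.map F →
      ∀ e ∈ c.toMultiset, c e = d e := by
    intro c d hc hd heq e he
    have hFe : F e ∈ d.toMultiset.map F := heq ▸ Multiset.mem_map_of_mem F he
    obtain ⟨f, hf, hfe⟩ := Multiset.mem_map.1 hFe
    obtain rfl := hinj d c hd hc f hf e he hfe
    rw [← Finsupp.count_toMultiset, ← Finsupp.count_toMultiset,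
      ← Multiset.count_map_eq_count F _ (fun a ha b hb => hinj c c hc hc a ha b hb) _ he,
      ← Multiset.count_map_eq_count F _ (fun a ha b hb => hinj d d hd hd a ha b hb) _ hf, heq]
  ext e
  by_cases he : e ∈ c.toMultiset
  · exact hmem c d hc hd heq e he
  by_cases he' : e ∈ d.toMultiset
  · exact (hmem d c hd hc heq.symm e he').symm
  · rw [Finsupp.mem_toMultiset, Finsupp.notMem_support_iff] at he he'
    rw [he, he']

end Stat

section Separation

variable {n k : ℕ} {z : Fin n → Fin k} {m : MonomialOrder.{0, 0} (Edge n)}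

/-! ### Consecutive blocks -/

/-- For consecutive blocks, strict inequality of block indices implies inequality of nodes, so edges
violating the sorting condition form an unsorted matching, whose monomial leads by `hm`. -/
theorem separating_of_monotone (hz : Monotone z)
    (hm : ∀ p ∈ sortedPairs n, m.toSyn p.2 < m.toSyn p.1) :
    Separating m (sortedPairs n ∪ blockPairs z) (stat z) := by
  refine separating_of_sorted (lam := Fin.val) Fin.val_injective ?_
  intro c hc u v y w huv hyw he hf h₁ h₂
  have hlt : ∀ {a b : Fin n}, (z a).val < (z b).val → a < b := by
    intro a b hab
    by_contra h
    exact absurd (hz (not_lt.1 h)) (not_le.2 hab)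
  have hred : ∀ Q, (pairExp (edge u v huv) (edge y w hyw), Q) ∈ sortedPairs n →
      edge u v huv ≠ edge y w hyw → False := fun Q hQ hef =>
    hc ⟨_, Q, Or.inl (Or.inl hQ), hm _ hQ, pairExp_le hef he hf⟩
  constructor
  · intro h
    have huy := hlt (h₁.trans_lt h)
    have huw := hlt (h₁.trans_lt (h.trans_le h₂))
    have hvy := hlt h
    have hvw := hlt (h.trans_le h₂)
    have hef : edge u v huv ≠ edge y w hyw := by
      rw [Ne, edge_eq_iff]
      omega
    -- Ends in the same block can come in either node order; in every case both ends of the first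
    -- edge precede both ends of the second.
    rcases lt_or_gt_of_ne huv with h₃ | h₃ <;> rcases lt_or_gt_of_ne hyw with h₄ | h₄
    · exact hred _ ⟨u, v, y, w, h₃, hvy, h₄, Or.inl rfl⟩ hef
    · exact hred _ ⟨u, v, w, y, h₃, hvw, h₄, Or.inl (by rw [edge_comm hyw])⟩ hef
    · exact hred _ ⟨v, u, y, w, h₃, huy, h₄, Or.inl (by rw [edge_comm huv])⟩ hef
    · exact hred _ ⟨v, u, w, y, h₃, huw, h₄, Or.inl (by rw [edge_comm hyw, edge_comm huv])⟩ hef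
  · rintro ⟨h, h'⟩
    have huy := hlt h
    have hwv := hlt h'
    have huw := hlt (h.trans_le h₂)
    have hyv := hlt (h₂.trans_lt h')
    have hef : edge u v huv ≠ edge y w hyw := by
      rw [Ne, edge_eq_iff]
      omega
    rcases lt_or_gt_of_ne hyw with h₄ | h₄
    · exact hred _ ⟨u, y, w, v, huy, h₄, hwv, Or.inr rfl⟩ hef
    · exact hred _ ⟨u, w, y, v, huw, h₄, hyv, Or.inr (by rw [edge_comm hyw])⟩ hef

/-! ### Arbitrary blocks -/

/-- A strictly concave function of the cyclic distance of `a ≤ b < n`, up to a constant. -/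
def labelWeight (n a b : ℕ) : ℕ := n * n - (b - a) * (n - (b - a))

/-- The product subtracted is at most `n * n`, so nothing is truncated; the constant only keeps the
weight a natural number. -/
theorem labelWeight_cast {n a b : ℕ} (hab : a ≤ b) (hb : b < n) :
    (labelWeight n a b : ℤ) = n * n - (b - a) * (n - (b - a)) := by
  have h : (b - a) * (n - (b - a)) ≤ n * n := Nat.mul_le_mul (by omega) (by omega)
  rw [labelWeight, Nat.cast_sub h]
  push_cast [show b - a ≤ n by omega, hab]
  ring

/-- The difference of the two sides is `2 * (c - b) * (n - (d - a))`, positive because `d - a < n`.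
-/
theorem labelWeight_lt_of_disjoint {n a b c d : ℕ} (hab : a ≤ b) (hbc : b < c) (hcd : c ≤ d)
    (hd : d < n) :
    labelWeight n a c + labelWeight n b d < labelWeight n a b + labelWeight n c d := by
  zify
  rw [labelWeight_cast (by omega) (by omega), labelWeight_cast (by omega) hd,
    labelWeight_cast hab (by omega), labelWeight_cast hcd hd]
  have : (0 : ℤ) < (c - b) * (n - (d - a)) := mul_pos (by omega) (by omega)
  nlinarith

/-- The difference of the two sides is `2 * (b - a) * (d - c)`. -/
theorem labelWeight_lt_of_nested {n a b c d : ℕ} (hab : a < b) (hbc : b ≤ c) (hcd : c < d)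
    (hd : d < n) :
    labelWeight n a c + labelWeight n b d < labelWeight n a d + labelWeight n b c := by
  zify
  rw [labelWeight_cast (by omega) (by omega), labelWeight_cast (by omega) hd,
    labelWeight_cast (by omega) hd, labelWeight_cast hbc (by omega)]
  have : (0 : ℤ) < (b - a) * (d - c) := mul_pos (by omega) (by omega)
  nlinarith

/-- The weight of an edge, depending only on the labels of its end nodes. -/
def edgeWeight (l : Fin n → ℕ) (e : Edge n) : ℕ :=
  labelWeight n (labelPair l e).1 (labelPair l e).2

theorem edgeWeight_edge {l : Fin n → ℕ} {u v : Fin n} (h : u ≠ v) (hl : l u ≤ l v) :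
    edgeWeight l (edge u v h) = labelWeight n (l u) (l v) := by
  rw [edgeWeight, labelPair_edge h hl]

/-- The number of end nodes of an edge that differ from their label. -/
def offLabelCount (l : Fin n → ℕ) (e : Edge n) : ℕ :=
  Sym2.lift ⟨fun u v => (if l u = u then 0 else 1) + (if l v = v then 0 else 1),
    fun _ _ => add_comm _ _⟩ e.1

/-- The monomial order comparing first the weights of the edges, then the numbers of end nodes that
differ from their label, then breaking ties by `m`. -/
noncomputable def labelOrder (l : Fin n → ℕ) (m : MonomialOrder.{0, 0} (Edge n)) :
    MonomialOrder.{0, 0} (Edge n) :=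
  weightedOrder (weightedOrder m (Finsupp.weight (offLabelCount l)))
    (Finsupp.weight (edgeWeight l))

theorem weight_pairExp (w : Edge n → ℕ) (e f : Edge n) :
    Finsupp.weight w (pairExp e f) = w e + w f := by
  simp [pairExp, Finsupp.weight_single]

theorem labelOrder_pairExp_lt {l : Fin n → ℕ} {e f e' f' : Edge n}
    (h : edgeWeight l e + edgeWeight l f < edgeWeight l e' + edgeWeight l f') :
    (labelOrder l m).toSyn (pairExp e f) < (labelOrder l m).toSyn (pairExp e' f') := by
  rw [labelOrder, weightedOrder_lt_iff, weight_pairExp, weight_pairExp]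
  exact Or.inl h

theorem labelOrder_single_lt {l : Fin n → ℕ} {e f : Edge n}
    (h : edgeWeight l e = edgeWeight l f) (h' : offLabelCount l e < offLabelCount l f) :
    (labelOrder l m).toSyn (Finsupp.single e 1) < (labelOrder l m).toSyn (Finsupp.single f 1) := by
  rw [labelOrder, weightedOrder_lt_iff, weightedOrder_lt_iff]
  simp only [Finsupp.weight_single, one_smul]
  exact Or.inr ⟨h, Or.inl h'⟩

variable {p : Fin k → Fin n} (hp : ∀ i, z (p i) = i)
include hp

/-- For two different blocks the edge joining their representatives exists. It has the same weight
and no end off its label, so it is the unique smallest edge between these blocks. Inside a single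
block there is no such edge. -/
theorem label_eq_of_irreducible {c : Edge n →₀ ℕ}
    (hc : ¬ Reducible (labelOrder (fun u => (p (z u)).val) m) (sortedPairs n ∪ blockPairs z) c)
    {u v : Fin n} (huv : u ≠ v) (he : edge u v huv ∈ c.support)
    (hlt : (p (z u)).val < (p (z v)).val) : p (z u) = u ∧ p (z v) = v := by
  have hpinj : Function.Injective p := fun i j h => by rw [← hp i, h, hp]
  have hne : p (z u) ≠ p (z v) := fun h => hlt.ne (congrArg Fin.val h)
  by_contra hnot
  have hle := single_le_of_irreducible (lam := fun i => (p i).val)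
    (Fin.val_injective.comp hpinj) hc he (f := edge (p (z u)) (p (z v)) hne) (by
      rw [labelPair_edge huv hlt.le, labelPair_edge hne (by simpa only [hp] using hlt.le)]
      simp only [hp])
  refine absurd (labelOrder_single_lt (m := m) ?_ ?_) hle.not_gt
  · rw [edgeWeight_edge huv hlt.le, edgeWeight_edge hne (by simpa only [hp] using hlt.le)]
    simp only [hp]
  · simp only [offLabelCount, edge, Sym2.lift_mk, hp, Fin.val_inj, if_true]
    rw [not_and_or] at hnot
    split_ifs <;> simp_all

/-- Two cases make an unsorted pair of edges reducible. If both edges join different blocks, their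
ends are representatives, so labels are the nodes themselves and the usual sorting move applies. If
one edge lies inside a block, exchanging its two equally labelled ends shows that both other
matchings have the same, smaller weight; hence it does not matter which of them the sorted basis
provides. -/
theorem separating_labelOrder :
    Separating (labelOrder (fun u => (p (z u)).val) m) (sortedPairs n ∪ blockPairs z) (stat z) := by
  have hpinj : Function.Injective p := fun i j h => by rw [← hp i, h, hp]
  refine separating_of_sorted (lam := fun i => (p i).val) (Fin.val_injective.comp hpinj) ?_
  intro c hc u v y w huv hyw he hf h₁ h₂
  set l : Fin n → ℕ := fun u => (p (z u)).val
  change l u ≤ l v at h₁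
  change l y ≤ l w at h₂
  change ¬ l v < l y ∧ ¬ (l u < l y ∧ l w < l v)
  have hln : ∀ a, l a < n := fun a => (p (z a)).isLt
  have hne : ∀ {a b : Fin n}, l a < l b → a ≠ b := fun h h' => h.ne (congrArg l h')
  have hrep : ∀ {a b : Fin n} (hab : a ≠ b), edge a b hab ∈ c.support → l a < l b →
      l a = a ∧ l b = b := by
    intro a b hab h hlt
    obtain ⟨h₁, h₂⟩ := label_eq_of_irreducible hp hc hab h hlt
    exact ⟨congrArg Fin.val h₁, congrArg Fin.val h₂⟩
  have hred : ∀ e f, ((pairExp (edge u v huv) (edge y w hyw), pairExp e f) ∈ sortedPairs n ∨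
        (pairExp e f, pairExp (edge u v huv) (edge y w hyw)) ∈ sortedPairs n) →
      edgeWeight l e + edgeWeight l f < edgeWeight l (edge u v huv) + edgeWeight l (edge y w hyw) →
      edge u v huv ≠ edge y w hyw → False := fun e f hQ hlt hef =>
    hc ⟨_, _, hQ.imp Or.inl Or.inl, labelOrder_pairExp_lt hlt, pairExp_le hef he hf⟩
  have hred' : ∀ (huy : u ≠ y) (huw : u ≠ w) (hvy : v ≠ y) (hvw : v ≠ w),
      edgeWeight l (edge u y huy) + edgeWeight l (edge v w hvw) <
        edgeWeight l (edge u v huv) + edgeWeight l (edge y w hyw) →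
      edgeWeight l (edge u w huw) + edgeWeight l (edge v y hvy) <
        edgeWeight l (edge u v huv) + edgeWeight l (edge y w hyw) → False := by
    intro huy huw hvy hvw hlt hlt'
    have hef : edge u v huv ≠ edge y w hyw := by
      rw [Ne, edge_eq_iff]
      tauto
    obtain ⟨Q, hQ, rfl | rfl⟩ := exists_sortedPairs_of_disjoint huv hyw huy huw hvy hvw
    · exact hred _ _ hQ hlt hef
    · exact hred _ _ hQ hlt' hef
  constructor
  · intro h
    have huy := h₁.trans_lt h
    have hvw := h.trans_le h₂
    have huw := h₁.trans_lt hvw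
    have hlt := labelWeight_lt_of_disjoint h₁ h h₂ (hln w)
    by_cases heq : l u = l v ∨ l y = l w
    · refine hred' (hne huy) (hne huw) (hne h) (hne hvw) ?_ ?_
      · rwa [edgeWeight_edge _ huy.le, edgeWeight_edge _ hvw.le, edgeWeight_edge _ h₁,
          edgeWeight_edge _ h₂]
      · rw [edgeWeight_edge _ huw.le, edgeWeight_edge _ h.le, edgeWeight_edge _ h₁,
          edgeWeight_edge _ h₂]
        rcases heq with heq | heq
        · rw [heq] at hlt ⊢
          omega
        · rw [heq] at hlt ⊢
          omega
    · rw [not_or] at heq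
      obtain ⟨hu, hv⟩ := hrep huv he (lt_of_le_of_ne h₁ heq.1)
      obtain ⟨hy, hw⟩ := hrep hyw hf (lt_of_le_of_ne h₂ heq.2)
      refine hred _ _ (Or.inl ⟨u, v, y, w, by omega, by omega, by omega, Or.inl rfl⟩) ?_ ?_
      · rwa [edgeWeight_edge _ huy.le, edgeWeight_edge _ hvw.le, edgeWeight_edge _ h₁,
          edgeWeight_edge _ h₂]
      · rw [Ne, edge_eq_iff]
        omega
  · rintro ⟨h, h'⟩
    have huw := h.trans_le h₂
    have hyv := h₂.trans_lt h'
    have hlt := labelWeight_lt_of_nested h h₂ h' (hln v)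
    by_cases heq : l y = l w
    · refine hred' (hne h) (hne huw) (hne hyv).symm (hne h').symm ?_ ?_
      · rw [edge_comm (hne h').symm, edgeWeight_edge _ h.le, edgeWeight_edge _ h'.le,
          edgeWeight_edge _ h₁, edgeWeight_edge _ h₂]
        rw [heq] at hlt ⊢
        omega
      · rwa [edge_comm (hne hyv).symm, edgeWeight_edge _ huw.le, edgeWeight_edge _ hyv.le,
          edgeWeight_edge _ h₁, edgeWeight_edge _ h₂]
    · obtain ⟨hu, hv⟩ := hrep huv he (huw.trans h')
      obtain ⟨hy, hw⟩ := hrep hyw hf (lt_of_le_of_ne h₂ heq)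
      refine hred _ _ (Or.inl ⟨u, y, w, v, by omega, by omega, by omega, Or.inr rfl⟩) ?_ ?_
      · rwa [edgeWeight_edge _ huw.le, edgeWeight_edge _ hyv.le, edgeWeight_edge _ h₁,
          edgeWeight_edge _ h₂]
      · rw [Ne, edge_eq_iff]
        omega

end Separation

/-! ### Gröbner bases -/

section Groebner

variable {K : Type*} [Field K] {n k : ℕ} {m : MonomialOrder.{0, 0} (Edge n)}

theorem isGroebnerBasis_addIdeal {z : Fin n → Fin k}
    (h : Separating m (sortedPairs n ∪ blockPairs z) (stat z)) :
    IsGroebnerBasis m (sortedBasis K n ∪ linearBinomials K z) (addIdeal K z) := by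
  rw [← binomial_image_sortedPairs, ← binomial_image_blockPairs, ← Set.image_union]
  exact h.isGroebnerBasis (stat_eq_of_mem z)
    ((finite_sortedPairs n).union (finite_blockPairs z)) (addMap K z) (addMap_monomial z K)

/-- If all unsorted monomials are larger than the sorted ones, the sorted basis is reduced. -/
theorem isReducedGroebnerBasis_of_lt
    (hm : ∀ p ∈ sortedPairs n, m.toSyn p.2 < m.toSyn p.1)
    {I : Ideal (MvPolynomial (Edge n) K)} (hI : IsGroebnerBasis m (sortedBasis K n) I) :
    IsReducedGroebnerBasis m (sortedBasis K n) I := by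
  classical
  refine ⟨hI, ?_, ?_⟩
  · rw [← binomial_image_sortedPairs]
    rintro _ ⟨p, hp, rfl⟩
    exact (degree_binomial (hm p hp)).2
  · rw [← binomial_image_sortedPairs]
    rintro _ ⟨p, hp, rfl⟩ _ ⟨q, hq, rfl⟩ hne c hc hle
    rw [show m.degree (binomial K q) = q.1 from (degree_binomial (hm q hq)).1] at hle
    have hc' : c = p.1 ∨ c = p.2 := by
      by_contra h
      rw [not_or] at h
      rw [binomial, mem_support_iff, coeff_sub, coeff_monomial, coeff_monomial,
        if_neg (Ne.symm h.1), if_neg (Ne.symm h.2), sub_zero] at hc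
      exact hc rfl
    rcases hc' with rfl | rfl
    · have h₁ := sortedPairs_fst_eq_of_le hq hp hle
      exact hne (by rw [Prod.ext h₁ (sortedPairs_snd_eq hq hp h₁)])
    · exact sortedPairs_not_fst_le_snd hq hp hle

/-- If the sorted basis is reduced, all unsorted monomials are larger than the sorted ones. -/
theorem lt_of_isReducedGroebnerBasis {I : Ideal (MvPolynomial (Edge n) K)}
    (hI : IsReducedGroebnerBasis m (sortedBasis K n) I) :
    ∀ p ∈ sortedPairs n, m.toSyn p.2 < m.toSyn p.1 := by
  classical
  intro p hp
  by_contra hlt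
  have hne : p.1 ≠ p.2 := sortedPairs_fst_ne_snd hp hp
  have hlt' : m.toSyn p.1 < m.toSyn p.2 :=
    lt_of_le_of_ne (not_lt.1 hlt) fun h => hne (m.toSyn.injective h)
  obtain ⟨q, hq, hqp, hqp'⟩ := exists_sortedPairs_ne hp
  have hdeg : m.degree (binomial K p) = p.2 := by
    rw [show binomial K p = -binomial K (p.2, p.1) from binomial_swap _ _, m.degree_neg]
    exact (degree_binomial hlt').1
  have hmem : ∀ p ∈ sortedPairs n, binomial K p ∈ sortedBasis K n := fun p hp => by
    rw [← binomial_image_sortedPairs]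
    exact ⟨p, hp, rfl⟩
  -- The sorted monomial `p.2` would lead `binomial K p` while also occurring in the different
  -- element `binomial K q`, contradicting reducedness.
  refine hI.2.2 _ (hmem q hq) _ (hmem p hp) ?_ p.2 ?_ hdeg.le
  · intro h
    rw [binomial, binomial, hqp, sub_left_inj] at h
    exact hqp' (monomial_left_injective one_ne_zero h).symm
  · rw [binomial, mem_support_iff, coeff_sub, coeff_monomial, coeff_monomial, if_pos hqp,
      if_neg (sortedPairs_fst_ne_snd hq hp)]
    simp

theorem exists_monomialOrder (σ : Type) [Finite σ] : Nonempty (MonomialOrder.{0, 0} σ) := by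
  have := Fintype.ofFinite σ
  let _ : LinearOrder σ := LinearOrder.lift' (Fintype.equivFin σ) (Fintype.equivFin σ).injective
  exact ⟨MonomialOrder.lex⟩

theorem labelOrder_val_lt : ∀ p ∈ sortedPairs n,
    (labelOrder (fun u => u.val) m).toSyn p.2 < (labelOrder (fun u => u.val) m).toSyn p.1 := by
  rintro p ⟨a, b, c, d, hab, hbc, hcd, rfl | rfl⟩
  · refine labelOrder_pairExp_lt ?_
    rw [edgeWeight_edge _ hab.le, edgeWeight_edge _ hcd.le, edgeWeight_edge _ (hab.trans hbc).le,
      edgeWeight_edge _ (hbc.trans hcd).le]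
    exact labelWeight_lt_of_disjoint hab.le hbc hcd.le d.isLt
  · refine labelOrder_pairExp_lt ?_
    rw [edgeWeight_edge _ hbc.le, edgeWeight_edge _ ((hab.trans hbc).trans hcd).le,
      edgeWeight_edge _ (hab.trans hbc).le, edgeWeight_edge _ (hbc.trans hcd).le]
    exact labelWeight_lt_of_nested hab hbc.le hcd d.isLt

/-- For singleton blocks the linear binomials are zero and cause no reductions, so the sorted pairs
separate on their own. -/
theorem separating_sortedPairs :
    Separating (labelOrder (fun u => u.val) m) (sortedPairs n) (stat (id : Fin n → Fin n)) := by
  have h := separating_labelOrder (z := (id : Fin n → Fin n)) (p := id) (m := m) fun _ => rfl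
  have hred : ∀ c, Reducible (labelOrder (fun u => u.val) m)
      (sortedPairs n ∪ blockPairs (id : Fin n → Fin n)) c →
      Reducible (labelOrder (fun u => u.val) m) (sortedPairs n) c := by
    have heq : ∀ q ∈ blockPairs (id : Fin n → Fin n), q.1 = q.2 := by
      rintro q ⟨u, v, y, w, huv, hyw, h₁, h₂, rfl⟩
      obtain rfl : u = y := h₁
      obtain rfl : v = w := h₂
      rfl
    rintro c ⟨P, Q, (hS | hS) | (hS | hS), hlt, hle⟩
    · exact ⟨P, Q, Or.inl hS, hlt, hle⟩
    · exact absurd (congrArg _ (heq _ hS)) hlt.ne'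
    · exact ⟨P, Q, Or.inr hS, hlt, hle⟩
    · exact absurd (congrArg _ (heq _ hS)) hlt.ne
  exact fun c c' hT hc hc' => h c c' hT (mt (hred c) hc) (mt (hred c') hc')

theorem isReducedGroebnerBasis_sortedBasis :
    IsReducedGroebnerBasis (labelOrder (fun u => u.val) m) (sortedBasis K n)
      (hypersimplexIdeal K n) := by
  refine isReducedGroebnerBasis_of_lt labelOrder_val_lt ?_
  rw [← binomial_image_sortedPairs]
  -- The hypersimplex map is by definition the additive map for the identity block assignment.
  exact separating_sortedPairs.isGroebnerBasis (stat_eq_of_mem_sortedPairs _)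
    (finite_sortedPairs n) (addMap K (id : Fin n → Fin n)) (addMap_monomial _ K)

end Groebner

/-! ### Markov bases -/

section Markov

variable {n k : ℕ}

/-- The move of a binomial. -/
def pairMove (p : (Edge n →₀ ℕ) × (Edge n →₀ ℕ)) (e : Edge n) : ℤ := p.1 e - p.2 e

theorem pairMove_image_sortedPairs (n : ℕ) :
    pairMove '' sortedPairs n = sortedCycleMoves n := by
  classical
  have h : ∀ e f e' f' : Edge n, pairMove (pairExp e f, pairExp e' f') =
      Pi.single e 1 + Pi.single f 1 - Pi.single e' 1 - Pi.single f' 1 := by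
    intro e f e' f'
    ext g
    simp [pairMove, pairExp, Finsupp.single_apply, Pi.single_apply, eq_comm]
    ring
  ext q
  constructor
  · rintro ⟨p, ⟨a, b, c, d, hab, hbc, hcd, rfl | rfl⟩, rfl⟩
    · exact ⟨a, b, c, d, hab, hbc, hcd, Or.inl (h _ _ _ _)⟩
    · exact ⟨a, b, c, d, hab, hbc, hcd, Or.inr (h _ _ _ _)⟩
  · rintro ⟨a, b, c, d, hab, hbc, hcd, rfl | rfl⟩
    · exact ⟨_, ⟨a, b, c, d, hab, hbc, hcd, Or.inl rfl⟩, h _ _ _ _⟩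
    · exact ⟨_, ⟨a, b, c, d, hab, hbc, hcd, Or.inr rfl⟩, h _ _ _ _⟩

theorem pairMove_image_blockPairs (z : Fin n → Fin k) :
    pairMove '' blockPairs z = blockMoves z := by
  classical
  have h : ∀ e f : Edge n, pairMove (Finsupp.single e 1, Finsupp.single f 1) =
      Pi.single e 1 - Pi.single f 1 := by
    intro e f
    ext g
    simp [pairMove, Finsupp.single_apply, Pi.single_apply, eq_comm]
  ext q
  constructor
  · rintro ⟨p, ⟨u, v, y, w, huv, hyw, h₁, h₂, rfl⟩, rfl⟩
    exact ⟨u, v, y, w, huv, hyw, h₁, h₂, h _ _⟩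
  · rintro ⟨u, v, y, w, huv, hyw, h₁, h₂, rfl⟩
    exact ⟨_, ⟨u, v, y, w, huv, hyw, h₁, h₂, rfl⟩, h _ _⟩

theorem edgeStat_apply (z : Fin n → Fin k) (e : Edge n) (i : Fin k) :
    edgeStat z e i = ∑ v : Fin n with z v = i, if v ∈ e.1 then 1 else 0 := by
  classical
  obtain ⟨u, v, h, rfl, -⟩ := exists_edge_le (fun _ => 0) e
  have hsplit : ∀ a : Fin n, (if a ∈ (edge u v h).1 then 1 else 0) =
      (if a = u then 1 else 0) + (if a = v then 1 else 0) := by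
    intro a
    simp only [edge, Sym2.mem_iff]
    split_ifs with h₁ h₂ h₃ <;> simp_all
  rw [Finset.sum_congr rfl fun a _ => hsplit a, Finset.sum_add_distrib, Finset.sum_ite_eq',
    Finset.sum_ite_eq', edgeStat_edge]
  simp [Finsupp.single_apply]

/-- Double counting of incidences between edges and nodes of the block. -/
theorem suffStat_coe (z : Fin n → Fin k) (c : Edge n →₀ ℕ) (i : Fin k) :
    suffStat z (⇑c) i = stat z c i := by
  classical
  rw [stat, Finsupp.weight_eq_sum, Finsupp.finsetSum_apply, suffStat]
  simp only [deg, Finsupp.smul_apply, edgeStat_apply, smul_eq_mul, Finset.mul_sum, mul_ite, mul_one,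
    mul_zero, Finset.sum_filter]
  conv_rhs => rw [Finset.sum_comm]
  refine Finset.sum_congr rfl fun v _ => ?_
  split_ifs <;> simp

theorem suffStat_eq_iff (z : Fin n → Fin k) (c d : Edge n →₀ ℕ) :
    suffStat z (⇑c) = suffStat z (⇑d) ↔ stat z c = stat z d := by
  rw [funext_iff, DFunLike.ext_iff]
  simp only [suffStat_coe]

/-- Binomials that separate the fibers form a Markov basis. -/
theorem Separating.isMarkovBasis {m : MonomialOrder.{0, 0} (Edge n)} {z : Fin n → Fin k}
    {S : Set ((Edge n →₀ ℕ) × (Edge n →₀ ℕ))} (hS : Separating m S (stat z))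
    (hT : ∀ p ∈ S, stat z p.1 = stat z p.2) (hfin : S.Finite) :
    IsMarkovBasis (suffStat z) (pairMove '' S) := by
  refine ⟨hfin.image _, ?_, ?_⟩
  · rintro _ ⟨p, hp, rfl⟩ g h hgh
    obtain ⟨c, rfl⟩ := Finsupp.equivFunOnFinite.surjective g
    obtain ⟨d, rfl⟩ := Finsupp.equivFunOnFinite.surjective h
    refine (suffStat_eq_iff z d c).2 ?_
    have : c + p.1 = d + p.2 := by
      ext e
      have := hgh e
      simp only [Finsupp.equivFunOnFinite_apply, pairMove] at this
      simp only [Finsupp.add_apply]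
      omega
    have := congrArg (stat z) this
    rw [map_add, map_add, hT p hp] at this
    exact (add_right_cancel this).symm
  · intro g h hgh
    obtain ⟨c, rfl⟩ := Finsupp.equivFunOnFinite.surjective g
    obtain ⟨d, rfl⟩ := Finsupp.equivFunOnFinite.surjective h
    refine Relation.ReflTransGen.lift (fun c : Edge n →₀ ℕ => Finsupp.equivFunOnFinite c) ?_ _ _
      (hS.reflTransGen hT ((suffStat_eq_iff z c d).1 hgh))
    rintro a b ⟨⟨P, Q, hPQ, hstep⟩, hab⟩
    refine ⟨?_, (suffStat_eq_iff z b a).2 hab⟩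
    have hstep' : ∀ e, a e + Q e = b e + P e := fun e => DFunLike.congr_fun hstep e
    -- A step replaces `P` by `Q`: it subtracts the move of `(P, Q)`, or adds that of `(Q, P)`.
    rcases hPQ with hPQ | hPQ
    · refine ⟨_, ⟨_, hPQ, rfl⟩, Or.inr fun e => ?_⟩
      have := hstep' e
      simp only [Finsupp.equivFunOnFinite_apply, pairMove]
      omega
    · refine ⟨_, ⟨_, hPQ, rfl⟩, Or.inl fun e => ?_⟩
      have := hstep' e
      simp only [Finsupp.equivFunOnFinite_apply, pairMove]
      omega

end Markov

end AdditiveSBM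

theorem mainTheorem4 (K : Type*) [Field K] (n k : ℕ) (z : Fin n → Fin k)
    (hz : Function.Surjective z) :
    (∃ m : MonomialOrder.{0, 0} (AdditiveSBM.Edge n),
      AdditiveSBM.IsReducedGroebnerBasis m (AdditiveSBM.sortedBasis K n)
        (AdditiveSBM.hypersimplexIdeal K n)) ∧
    (∃ m : MonomialOrder.{0, 0} (AdditiveSBM.Edge n),
      AdditiveSBM.IsGroebnerBasis m
        (AdditiveSBM.sortedBasis K n ∪ AdditiveSBM.linearBinomials K z)
        (AdditiveSBM.addIdeal K z)) ∧
    (Monotone z → ∀ m : MonomialOrder.{0, 0} (AdditiveSBM.Edge n),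
      AdditiveSBM.IsReducedGroebnerBasis m (AdditiveSBM.sortedBasis K n)
        (AdditiveSBM.hypersimplexIdeal K n) →
      AdditiveSBM.IsGroebnerBasis m
        (AdditiveSBM.sortedBasis K n ∪ AdditiveSBM.linearBinomials K z)
        (AdditiveSBM.addIdeal K z)) ∧
    AdditiveSBM.IsMarkovBasis (AdditiveSBM.suffStat z)
      (AdditiveSBM.sortedCycleMoves n ∪ AdditiveSBM.blockMoves z) := by
  obtain ⟨m⟩ := AdditiveSBM.exists_monomialOrder (AdditiveSBM.Edge n)
  have hsep := AdditiveSBM.separating_labelOrder (m := m) (Function.surjInv_eq hz)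
  refine ⟨⟨_, AdditiveSBM.isReducedGroebnerBasis_sortedBasis (m := m)⟩,
    ⟨_, AdditiveSBM.isGroebnerBasis_addIdeal hsep⟩, fun hmono m' hm' => ?_, ?_⟩
  · exact AdditiveSBM.isGroebnerBasis_addIdeal
      (AdditiveSBM.separating_of_monotone hmono (AdditiveSBM.lt_of_isReducedGroebnerBasis hm'))
  · rw [← AdditiveSBM.pairMove_image_sortedPairs, ← AdditiveSBM.pairMove_image_blockPairs,
      ← Set.image_union]
    exact hsep.isMarkovBasis (AdditiveSBM.stat_eq_of_mem z)
      ((AdditiveSBM.finite_sortedPairs n).union (AdditiveSBM.finite_blockPairs z))
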